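/- Let $m$ be a positive integer and let $\Delta\subseteq 2^{[m]}$ be a simplicial complex on $[m]=\{1,\dots,m\}$, that is, every subset of a face $F\in\Delta$ lies in $\Delta$, and the union of the faces is $[m]$. Let $G=G(\Delta)$ be its underlying graph, with vertex set $[m]$ and with the 2-element faces of $\Delta$ as edges. Let $\mathbb{S}^m(G)$ be the linear space of real symmetric $m\times m$ matrices $(\sigma_{ij})$ with $\sigma_{ij}=0$ whenever $i\neq j$ and $\{i,j\}$ is not an edge of $G$, and let $\mathbb{S}^m_{\succeq 0}(G)$ be the cone of positive semidefinite matrices in $\mathbb{S}^m(G)$. Define the polynomial map $$\phi_\Delta:\prod_{F\in\Delta}\mathbb{R}^{F}\to\mathbb{R}^{m\times m},\qquad \phi_\Delta(\gamma)=\Gamma(\gamma)\Gamma(\gamma)^T,$$ where, for $\gamma=(\gamma_{i,F}: F\in\Delta,\ i\in F)$, the $[m]\times\Delta$ matrix $\Gamma(\gamma)$ has entries $\Gamma(\gamma)_{i,F}=\gamma_{i,F}$ if $i\in F$ and $\Gamma(\gamma)_{i,F}=0$ otherwise. Then the image of $\phi_\Delta$ is contained in $\mathbb{S}^m_{\succeq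 0}(G)$, is closed, is full-dimensional (it has nonempty interior relative to $\mathbb{S}^m(G)$), and is a semi-algebraic set (a Boolean combination of finitely many sets of the form $\{p>0\}$, where $p$ is a real polynomial in the matrix entries). -/

import Mathlib

namespace SimplicialParam

/-- `Δ` is a simplicial complex on `[m]` (modelled as `Fin m`): every subset of a face is a face,
and the union of the faces (the ground set) is all of `[m]`. As a collection of subsets it
may contain the empty face. -/
structure IsSimplicialComplexOn {m : ℕ} (Δ : Finset (Finset (Fin m))) : Prop where
  down_closed : ∀ F ∈ Δ, ∀ E, E ⊆ F → E ∈ Δ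
  ground_set : ∀ i : Fin m, ∃ F ∈ Δ, i ∈ F

/-- The underlying graph: its edges are the 2-element faces. -/
def underlyingGraph {m : ℕ} (Δ : Finset (Finset (Fin m))) : SimpleGraph (Fin m) where
  Adj i j := i ≠ j ∧ ({i, j} : Finset (Fin m)) ∈ Δ
  symm := ⟨fun i j h => ⟨h.1.symm, by rw [Finset.pair_comm]; exact h.2⟩⟩
  loopless := ⟨fun _ h => h.1 rfl⟩

/-- The parameter space `∏_{F ∈ Δ} ℝ^F`, whose points are families `γ = (γ_{i,F})` indexed by
`F ∈ Δ` and `i ∈ F`. -/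
abbrev Param {m : ℕ} (Δ : Finset (Finset (Fin m))) : Type :=
  (F : {F : Finset (Fin m) // F ∈ Δ}) → {i : Fin m // i ∈ F.1} → ℝ

/-- The `[m] × Δ` matrix `Γ(γ)` with entries `γ_{i,F}` if `i ∈ F` and `0` otherwise. -/
def Gam {m : ℕ} {Δ : Finset (Finset (Fin m))} (γ : Param Δ) :
    Matrix (Fin m) {F : Finset (Fin m) // F ∈ Δ} ℝ :=
  Matrix.of fun i F => if h : i ∈ F.1 then γ F ⟨i, h⟩ else 0

/-- The polynomial map `φ_Δ(γ) = Γ(γ) Γ(γ)ᵀ`. -/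
def phi {m : ℕ} (Δ : Finset (Finset (Fin m))) (γ : Param Δ) : Matrix (Fin m) (Fin m) ℝ :=
  Gam γ * (Gam γ).transpose

/-- The space `𝕊^m(G)` of symmetric matrices with zeros at the non-edges of `G`. -/
def symSpace {m : ℕ} (G : SimpleGraph (Fin m)) : Submodule ℝ (Matrix (Fin m) (Fin m) ℝ) where
  carrier := {S | S.IsSymm ∧ ∀ i j, i ≠ j → ¬ G.Adj i j → S i j = 0}
  add_mem' := fun {A B} hA hB => ⟨hA.1.add hB.1, fun i j hij hG => by
    rw [Matrix.add_apply, hA.2 i j hij hG, hB.2 i j hij hG, add_zero]⟩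
  zero_mem' := ⟨Matrix.isSymm_zero, fun _ _ _ _ => rfl⟩
  smul_mem' := fun c A hA => ⟨hA.1.smul c, fun i j hij hG => by
    rw [Matrix.smul_apply, hA.2 i j hij hG, smul_zero]⟩

/-- The cone `𝕊_{⪰0}^m(G)` of positive semidefinite matrices with zeros at the non-edges. -/
def psdCone {m : ℕ} (G : SimpleGraph (Fin m)) : Set (Matrix (Fin m) (Fin m) ℝ) :=
  {S | S ∈ symSpace G ∧ S.PosSemidef}

/-- A subset of `ℝ^ι` is semi-algebraic if it belongs to the smallest family of subsets of `ℝ^ι`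
that contains the sets `{x | 0 < p x}`, `p` a real polynomial, and is closed under finite unions,
finite intersections and complements. -/
def IsSemialgebraic {ι : Type*} (A : Set (ι → ℝ)) : Prop :=
  A ∈ BooleanSubalgebra.closure
    {B : Set (ι → ℝ) | ∃ p : MvPolynomial ι ℝ, B = {x | 0 < MvPolynomial.eval x p}}

/-- A set of `m × m` matrices is semi-algebraic if it is so in `ℝ^{m × m}`, with the matrix
entries as coordinates. -/
def IsSemialgebraicMatrixSet {m : ℕ} (A : Set (Matrix (Fin m) (Fin m) ℝ)) : Prop :=
  IsSemialgebraic {x : Fin m × Fin m → ℝ | (Matrix.of fun i j => x (i, j)) ∈ A}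

/-- A subset `A` of a linear space `V` of matrices is full-dimensional in `V` if it has an interior
point relative to `V`. -/
def IsFullDimensionalIn {m : ℕ} (V : Submodule ℝ (Matrix (Fin m) (Fin m) ℝ))
    (A : Set (Matrix (Fin m) (Fin m) ℝ)) : Prop :=
  A ⊆ V ∧ (interior {x : V | (x : Matrix (Fin m) (Fin m) ℝ) ∈ A}).Nonempty

end SimplicialParam

namespace SimplicialParam

open Set Filter Topology

/-! The image consists of Gram matrices, and a face containing both i and j contains the edge ij;
this gives semidefiniteness and the zero pattern. It is closed because φ is proper: the trace of
φ(γ) is the sum of the squares of all parameters, so it bounds each of them (`isClosed_range_phi`).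
For the interior, entries 1 and σ_ij in the column of each edge ij produce every prescribed
off-diagonal part, and the vertex columns then add an arbitrary nonnegative amount to each diagonal
entry separately. So the image contains every matrix of the space whose diagonal dominates that of
the edge contribution, an open condition (`mem_range_phi_of_pos`).

The image is the projection of an algebraic set, so semialgebraicity is Tarski–Seidenberg, proved
here by the Cohen–Hörmander method. A finite list of polynomials in t, with coefficients depending
on a parameter, cuts the line at its zeros. Suppose that the cuttings at two parameters correspond,
signs included. If the list contains the derivative of v and remainders of v modulo its members,
then the signs of v at the cut points are known, v is strictly monotone between them, and v is
unbounded at both ends. This determines where new zeros appear, so the correspondence refines to one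
for v (`CellCorrespondence.refine_sign`). Induction on the degree (`exists_isClassified`) leaves
only the signs of finitely many constant coefficients, which are semialgebraic conditions. Hence
finitely many semialgebraic sets decide which parameters have matching lists, and matching
parameters have the same answer to "does some t work?" (`IsSemialgebraic.exists_option`). -/

/-! ### Correspondences between cell decompositions of two lines. -/

/-- A correspondence between two cell decompositions of the line, with finite sets `Z` and `W` of
special points: `R s t` says that `s` and `t` lie in corresponding cells. -/
structure CellCorrespondence (Z W : Set ℝ) (R : ℝ → ℝ → Prop) : Prop where
  finite_left : Z.Finite
  finite_right : W.Finite
  left_total : ∀ s, ∃ t, R s t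
  right_total : ∀ t, ∃ s, R s t
  cross : ∀ {s t s' t'}, R s t → R s' t' → s ≤ s' → t' ≤ t → R s t'
  difun : ∀ {s t s' t'}, R s t → R s' t → R s' t' → R s t'
  fill_left : ∀ {s s' t}, R s t → (∀ u ∈ uIcc s s', u ∉ Z) → R s' t
  fill_right : ∀ {s t t'}, R s t → (∀ u ∈ uIcc t t', u ∉ W) → R s t'
  mem_iff : ∀ {s t}, R s t → (s ∈ Z ↔ t ∈ W)

namespace CellCorrespondence

variable {Z W : Set ℝ} {R : ℝ → ℝ → Prop}

lemma symm (h : CellCorrespondence Z W R) : CellCorrespondence W Z fun t s => R s t where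
  finite_left := h.finite_right
  finite_right := h.finite_left
  left_total := h.right_total
  right_total := h.left_total
  cross h₁ h₂ hs ht := h.cross h₂ h₁ ht hs
  difun h₁ h₂ h₃ := h.difun h₃ h₂ h₁
  fill_left := h.fill_right
  fill_right := h.fill_left
  mem_iff h₁ := (h.mem_iff h₁).symm

lemma neg (h : CellCorrespondence Z W R) :
    CellCorrespondence {s | -s ∈ Z} {t | -t ∈ W} fun s t => R (-s) (-t) where
  finite_left := h.finite_left.preimage neg_injective.injOn
  finite_right := h.finite_right.preimage neg_injective.injOn
  left_total s := by
    obtain ⟨t, ht⟩ := h.left_total (-s)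
    exact ⟨-t, by simpa using ht⟩
  right_total t := by
    obtain ⟨s, hs⟩ := h.right_total (-t)
    exact ⟨-s, by simpa using hs⟩
  -- Reversing both orders makes `cross` yield the opposite corner of the rectangle; `difun`
  -- recovers the wanted one.
  cross h₁ h₂ hs ht := h.difun h₁ (h.cross h₂ h₁ (neg_le_neg hs) (neg_le_neg ht)) h₂
  difun h₁ h₂ h₃ := h.difun h₁ h₂ h₃
  fill_left {s s' t} h₁ hu := h.fill_left h₁ fun u hm => by
    have := hu (-u) (by
      rw [mem_uIcc] at hm ⊢
      rcases hm with hm | hm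
      · exact Or.inr ⟨by linarith [hm.2], by linarith [hm.1]⟩
      · exact Or.inl ⟨by linarith [hm.2], by linarith [hm.1]⟩)
    simpa using this
  fill_right {s t t'} h₁ hu := h.fill_right h₁ fun u hm => by
    have := hu (-u) (by
      rw [mem_uIcc] at hm ⊢
      rcases hm with hm | hm
      · exact Or.inr ⟨by linarith [hm.2], by linarith [hm.1]⟩
      · exact Or.inl ⟨by linarith [hm.2], by linarith [hm.1]⟩)
    simpa using this
  mem_iff h₁ := h.mem_iff h₁

/-- Take a partner u of t. On whichever side of s it lies, one of the two given pairs is in crossing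
position with (u, t). -/
lemma convex_right (h : CellCorrespondence Z W R) {s t₁ t₂ t : ℝ} (h₁ : R s t₁) (h₂ : R s t₂)
    (ht₁ : t₁ ≤ t) (ht₂ : t ≤ t₂) : R s t := by
  obtain ⟨u, hu⟩ := h.right_total t
  rcases le_total u s with hus | hus
  · exact h.difun h₁ (h.cross hu h₁ hus ht₁) hu
  · exact h.cross h₂ hu hus ht₂

lemma convex_left (h : CellCorrespondence Z W R) {s₁ s₂ s t : ℝ} (h₁ : R s₁ t) (h₂ : R s₂ t)
    (hs₁ : s₁ ≤ s) (hs₂ : s ≤ s₂) : R s t :=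
  h.symm.convex_right h₁ h₂ hs₁ hs₂

/-- Data for refining a correspondence by a pair of functions: the signs of the derivatives agree
on corresponding cells, and so do the signs of the functions at the special points. -/
structure Compatible (Z : Set ℝ) (R : ℝ → ℝ → Prop) (p dp q dq : ℝ → ℝ) : Prop where
  deriv_left : ∀ s, HasDerivAt p (dp s) s
  deriv_right : ∀ t, HasDerivAt q (dq t) t
  continuous_left : Continuous dp
  continuous_right : Continuous dq
  sign_deriv : ∀ {s t}, R s t → SignType.sign (dp s) = SignType.sign (dq t)
  sign_special : ∀ {s t}, R s t → s ∈ Z → SignType.sign (p s) = SignType.sign (q t)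

variable {p dp q dq : ℝ → ℝ}

lemma Compatible.cont_left (c : Compatible Z R p dp q dq) : Continuous p :=
  continuous_iff_continuousAt.2 fun s => (c.deriv_left s).continuousAt

lemma Compatible.cont_right (c : Compatible Z R p dp q dq) : Continuous q :=
  continuous_iff_continuousAt.2 fun s => (c.deriv_right s).continuousAt

lemma Compatible.symm (c : Compatible Z R p dp q dq) (h : CellCorrespondence Z W R) :
    Compatible W (fun t s => R s t) q dq p dp where
  deriv_left := c.deriv_right
  deriv_right := c.deriv_left
  continuous_left := c.continuous_right
  continuous_right := c.continuous_left
  sign_deriv h₁ := (c.sign_deriv h₁).symm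
  sign_special h₁ h₂ := (c.sign_special h₁ ((h.mem_iff h₁).2 h₂)).symm

lemma Compatible.neg (c : Compatible Z R p dp q dq) :
    Compatible Z R (fun s => -p s) (fun s => -dp s) (fun t => -q t) (fun t => -dq t) where
  deriv_left s := (c.deriv_left s).neg
  deriv_right t := (c.deriv_right t).neg
  continuous_left := c.continuous_left.neg
  continuous_right := c.continuous_right.neg
  sign_deriv h₁ := by simp only [Left.sign_neg, c.sign_deriv h₁]
  sign_special h₁ h₂ := by simp only [Left.sign_neg, c.sign_special h₁ h₂]

lemma Compatible.comp_neg (c : Compatible Z R p dp q dq) :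
    Compatible {s | -s ∈ Z} (fun s t => R (-s) (-t)) (fun s => p (-s)) (fun s => -dp (-s))
      (fun t => q (-t)) (fun t => -dq (-t)) where
  deriv_left s := by
    simpa [Function.comp_def] using (c.deriv_left (-s)).comp s (hasDerivAt_neg s)
  deriv_right s := by
    simpa [Function.comp_def] using (c.deriv_right (-s)).comp s (hasDerivAt_neg s)
  continuous_left := (c.continuous_left.comp continuous_neg).neg
  continuous_right := (c.continuous_right.comp continuous_neg).neg
  sign_deriv h₁ := by simp only [Left.sign_neg, c.sign_deriv h₁]
  sign_special h₁ h₂ := c.sign_special h₁ h₂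

lemma exists_ball_disjoint {A : Set ℝ} (hA : A.Finite) {b : ℝ} (hb : b ∉ A) :
    ∃ ε > 0, ∀ u, b - ε ≤ u → u ≤ b + ε → u ∉ A := by
  obtain ⟨ε, hε, hball⟩ := Metric.isOpen_iff.1 hA.isClosed.isOpen_compl b hb
  refine ⟨ε / 2, by positivity, fun u h₁ h₂ => hball ?_⟩
  rw [Metric.mem_ball, Real.dist_eq, abs_lt]
  constructor <;> linarith

/-- If q ≤ 0 on the whole cell matched with s, then q still has a nonpositive value at the right end
b of that cell, so p is nonpositive at a partner of b. Thus p must decrease somewhere in between,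
and the derivative signs do not allow this. A cell without right end is excluded by the growth of
|q|. -/
lemma exists_pos_of_deriv_pos (h : CellCorrespondence Z W R) (c : Compatible Z R p dp q dq)
    (hq : Tendsto (fun t => |q t|) (cocompact ℝ) atTop) {s : ℝ} (hs : s ∉ Z) (hds : 0 < dp s)
    (hps : 0 < p s) : ∃ t, R s t ∧ 0 < q t := by
  by_contra! hcon
  obtain ⟨t₀, ht₀⟩ := h.left_total s
  have hdq : ∀ t, R s t → 0 < dq t := fun t ht => by
    rw [← sign_eq_one_iff, ← c.sign_deriv ht, sign_eq_one_iff]; exact hds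
  by_cases hb : BddAbove {t | R s t}
  · set b := sSup {t | R s t} with hbdef
    have hle : ∀ t, R s t → t ≤ b := fun t ht => le_csSup hb ht
    have happ : ∀ v, v < b → ∃ t, R s t ∧ v < t := fun v hv => by
      obtain ⟨t, ht, hvt⟩ := exists_lt_of_lt_csSup ⟨t₀, ht₀⟩ hv
      exact ⟨t, ht, hvt⟩
    -- A non-special supremum would have a neighbourhood free of special points, and the cell would
    -- extend beyond it.
    have hbW : b ∈ W := by
      by_contra hbW
      obtain ⟨ε, hε, hdis⟩ := exists_ball_disjoint h.finite_right hbW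
      obtain ⟨t, ht, hbt⟩ := happ (b - ε) (by linarith)
      have := hle (b + ε) (h.fill_right ht fun u hu => by
        rw [uIcc_of_le (by linarith [hle t ht])] at hu
        exact hdis u (by linarith [hu.1]) hu.2)
      linarith
    have hbR : ¬ R s b := fun hR => hs ((h.mem_iff hR).2 hbW)
    have hclos : b ∈ closure {t | R s t} := csSup_mem_closure ⟨t₀, ht₀⟩ hb
    have hqb : q b ≤ 0 :=
      closure_minimal (t := {t | q t ≤ 0}) (fun t ht => hcon t ht)
        (isClosed_le c.cont_right continuous_const) hclos
    have hdqb : 0 ≤ dq b :=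
      closure_minimal (t := {t | 0 ≤ dq t}) (fun t ht => (hdq t ht).le)
        (isClosed_le continuous_const c.continuous_right) hclos
    obtain ⟨a, ha⟩ := h.right_total b
    have hsa : s < a := by
      by_contra! has
      exact hbR (h.difun ht₀ (h.cross ha ht₀ has (hle t₀ ht₀)) ha)
    have hpa : p a ≤ 0 := by
      by_contra! hpa
      have := c.sign_special ha ((h.mem_iff ha).2 hbW)
      rw [sign_pos hpa] at this
      exact absurd (sign_eq_one_iff.1 this.symm) (not_lt.2 hqb)
    -- Since p s > 0 ≥ p a, the derivative is negative at some u between s and a. A partner v of u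
    -- is outside the cell of s, hence at or beyond b; as u < a, crossing matches u with b itself,
    -- where `dq` is nonnegative.
    obtain ⟨u, hu, hdu⟩ := exists_hasDerivAt_eq_slope p dp hsa c.cont_left.continuousOn
      fun x _ => c.deriv_left x
    have hdu' : dp u < 0 := by
      rw [hdu]; exact div_neg_of_neg_of_pos (by linarith) (by linarith)
    obtain ⟨v, hv⟩ := h.left_total u
    have hsv : ¬ R s v := fun hsv => by
      have h₁ := c.sign_deriv hv
      rw [sign_neg hdu', sign_pos (hdq v hsv)] at h₁
      exact absurd h₁ (by decide)
    have htv : t₀ < v := by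
      by_contra! hvt
      exact hsv (h.cross ht₀ hv hu.1.le hvt)
    have hbv : b ≤ v := by
      by_contra! hvb
      obtain ⟨t, ht, hvt⟩ := happ v hvb
      exact hsv (h.convex_right ht₀ ht htv.le hvt.le)
    have h₁ := c.sign_deriv (h.cross hv ha hu.2.le hbv)
    rw [sign_neg hdu'] at h₁
    exact absurd (sign_eq_neg_one_iff.1 h₁.symm) (not_lt.2 hdqb)
  · have hIci : ∀ t, t₀ ≤ t → R s t := fun t ht => by
      rw [not_bddAbove_iff] at hb
      obtain ⟨t₁, ht₁, htt⟩ := hb t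
      exact h.convex_right ht₀ ht₁ ht htt.le
    -- Here q increases along a half-line while staying nonpositive, so |q| cannot exceed |q t₀|.
    have hmono : MonotoneOn q (Ici t₀) :=
      monotoneOn_of_hasDerivWithinAt_nonneg (convex_Ici t₀) c.cont_right.continuousOn
        (fun x _ => (c.deriv_right x).hasDerivWithinAt)
        fun x hx => (hdq x (hIci x (interior_subset hx))).le
    have hlim : Tendsto (fun t => |q t|) atTop atTop := hq.mono_left atTop_le_cocompact
    obtain ⟨t, ht₁, ht₂⟩ :=
      ((hlim.eventually_gt_atTop |q t₀|).and (eventually_ge_atTop t₀)).exists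
    have h₁ := hmono self_mem_Ici ht₂ ht₂
    have h₂ := hcon t (hIci t ht₂)
    rw [abs_of_nonpos h₂, abs_of_nonpos (h₁.trans h₂)] at ht₁
    linarith

lemma exists_pos (h : CellCorrespondence Z W R) (c : Compatible Z R p dp q dq)
    (hq : Tendsto (fun t => |q t|) (cocompact ℝ) atTop) {s : ℝ} (hs : s ∉ Z) (hds : dp s ≠ 0)
    (hps : 0 < p s) : ∃ t, R s t ∧ 0 < q t := by
  rcases lt_or_gt_of_ne hds with hds | hds
  · have hq' : Tendsto (fun t => |q (-t)|) (cocompact ℝ) atTop :=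
      hq.comp (Homeomorph.neg ℝ).isClosedEmbedding.tendsto_cocompact
    obtain ⟨t, ht, hqt⟩ := h.neg.exists_pos_of_deriv_pos c.comp_neg hq' (s := -s)
      (by simpa using hs) (by simpa using hds) (by simpa using hps)
    exact ⟨-t, by simpa using ht, hqt⟩
  · exact h.exists_pos_of_deriv_pos c hq hs hds hps

lemma exists_neg (h : CellCorrespondence Z W R) (c : Compatible Z R p dp q dq)
    (hq : Tendsto (fun t => |q t|) (cocompact ℝ) atTop) {s : ℝ} (hs : s ∉ Z) (hds : dp s ≠ 0)
    (hps : p s < 0) : ∃ t, R s t ∧ q t < 0 := by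
  obtain ⟨t, ht, hqt⟩ := h.exists_pos c.neg (by simpa using hq) hs (neg_ne_zero.2 hds)
    (neg_pos.2 hps)
  exact ⟨t, ht, neg_pos.1 hqt⟩

/-- Near s, inside its cell, p changes sign. Both signs transfer to q on the matched cell, which is
convex, and the intermediate value theorem gives a zero there. -/
lemma exists_zero_of_deriv_pos (h : CellCorrespondence Z W R) (c : Compatible Z R p dp q dq)
    (hq : Tendsto (fun t => |q t|) (cocompact ℝ) atTop) {s : ℝ} (hs : s ∉ Z) (hds : 0 < dp s)
    (hps : p s = 0) : ∃ t, R s t ∧ q t = 0 := by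
  obtain ⟨t₀, ht₀⟩ := h.left_total s
  obtain ⟨ε, hε, hdis⟩ := exists_ball_disjoint h.finite_left hs
  have hR : ∀ u ∈ Icc (s - ε) (s + ε), R u t₀ := fun u hu =>
    h.fill_left ht₀ fun v hv => by
      have := uIcc_subset_Icc (a₂ := s - ε) (b₂ := s + ε) ⟨by linarith, by linarith⟩ hu hv
      exact hdis v this.1 this.2
  have hd : ∀ u ∈ Icc (s - ε) (s + ε), 0 < dp u := fun u hu => by
    rw [← sign_eq_one_iff, c.sign_deriv (hR u hu), ← c.sign_deriv ht₀, sign_eq_one_iff]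
    exact hds
  have hmono : StrictMonoOn p (Icc (s - ε) (s + ε)) :=
    strictMonoOn_of_hasDerivWithinAt_pos (convex_Icc _ _) c.cont_left.continuousOn
      (fun x _ => (c.deriv_left x).hasDerivWithinAt) fun x hx => hd x (interior_subset hx)
  have m₁ : s - ε ∈ Icc (s - ε) (s + ε) := ⟨le_rfl, by linarith⟩
  have m₂ : s + ε ∈ Icc (s - ε) (s + ε) := ⟨by linarith, le_rfl⟩
  have m₀ : s ∈ Icc (s - ε) (s + ε) := ⟨by linarith, by linarith⟩
  have h₁ : p (s - ε) < 0 := by rw [← hps]; exact hmono m₁ m₀ (by linarith)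
  have h₂ : 0 < p (s + ε) := by rw [← hps]; exact hmono m₀ m₂ (by linarith)
  obtain ⟨t₁, hR₁, hq₁⟩ := h.exists_neg c hq (hdis _ m₁.1 m₁.2) (hd _ m₁).ne' h₁
  obtain ⟨t₂, hR₂, hq₂⟩ := h.exists_pos c hq (hdis _ m₂.1 m₂.2) (hd _ m₂).ne' h₂
  replace hR₁ := h.difun ht₀ (hR _ m₁) hR₁
  replace hR₂ := h.difun ht₀ (hR _ m₂) hR₂
  obtain ⟨t, ht, hqt⟩ := intermediate_value_uIcc (a := t₁) (b := t₂)
    c.cont_right.continuousOn (mem_uIcc.2 (Or.inl ⟨hq₁.le, hq₂.le⟩))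
  refine ⟨t, ?_, hqt⟩
  rcases mem_uIcc.1 ht with ht | ht
  · exact h.convex_right hR₁ hR₂ ht.1 ht.2
  · exact h.convex_right hR₂ hR₁ ht.1 ht.2

lemma exists_sign_eq (h : CellCorrespondence Z W R) (c : Compatible Z R p dp q dq)
    (hq : Tendsto (fun t => |q t|) (cocompact ℝ) atTop) (hdp : ∀ s, dp s = 0 → s ∈ Z) (s : ℝ) :
    ∃ t, R s t ∧ SignType.sign (p s) = SignType.sign (q t) := by
  by_cases hs : s ∈ Z
  · obtain ⟨t, ht⟩ := h.left_total s
    exact ⟨t, ht, c.sign_special ht hs⟩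
  have hds : dp s ≠ 0 := fun h₀ => hs (hdp s h₀)
  rcases lt_trichotomy (p s) 0 with hp | hp | hp
  · obtain ⟨t, ht, hqt⟩ := h.exists_neg c hq hs hds hp
    exact ⟨t, ht, by rw [sign_neg hp, sign_neg hqt]⟩
  · have : ∃ t, R s t ∧ q t = 0 := by
      rcases lt_or_gt_of_ne hds with hds | hds
      · obtain ⟨t, ht, hqt⟩ := h.exists_zero_of_deriv_pos c.neg (by simpa using hq) hs
          (neg_pos.2 hds) (neg_eq_zero.2 hp)
        exact ⟨t, ht, neg_eq_zero.1 hqt⟩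
      · exact h.exists_zero_of_deriv_pos c hq hs hds hp
    obtain ⟨t, ht, hqt⟩ := this
    exact ⟨t, ht, by rw [hp, hqt]⟩
  · obtain ⟨t, ht, hqt⟩ := h.exists_pos c hq hs hds hp
    exact ⟨t, ht, by rw [sign_pos hp, sign_pos hqt]⟩

lemma sign_eq_of_forall_uIcc_ne_zero {f : ℝ → ℝ} (hf : Continuous f) {a b : ℝ}
    (h : ∀ u ∈ uIcc a b, f u ≠ 0) : SignType.sign (f a) = SignType.sign (f b) := by
  have key : ¬ (0 : ℝ) ∈ uIcc (f a) (f b) := fun h₀ => by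
    obtain ⟨u, hu, hfu⟩ := intermediate_value_uIcc hf.continuousOn h₀
    exact h u hu hfu
  rw [mem_uIcc] at key
  push Not at key
  rcases lt_or_gt_of_ne (h a left_mem_uIcc) with ha | ha
  · rw [sign_neg ha, sign_neg (key.1 ha.le)]
  · rw [sign_pos ha, sign_pos]
    by_contra! hb
    exact absurd (key.2 hb) (not_lt.2 ha.le)

/-- All of [s, s'] × [t', t] lies in matched cells, so p and q are monotone there in the same
direction. The two sign equalities then close a cycle of inequalities between the four signs. -/
lemma sign_eq_of_cross (h : CellCorrespondence Z W R) (c : Compatible Z R p dp q dq)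
    {s t s' t' : ℝ} (h₁ : R s t) (h₂ : R s' t') (hs : s ≤ s') (ht : t' ≤ t)
    (e₁ : SignType.sign (p s) = SignType.sign (q t))
    (e₂ : SignType.sign (p s') = SignType.sign (q t')) :
    SignType.sign (p s) = SignType.sign (q t') := by
  have h₃ := h.cross h₁ h₂ hs ht
  have h₄ := h.difun h₂ h₃ h₁
  have hp : ∀ u ∈ Icc s s', SignType.sign (dp u) = SignType.sign (dp s) := fun u hu => by
    rw [c.sign_deriv (h.convex_left h₁ h₄ hu.1 hu.2), c.sign_deriv h₁]
  have hq : ∀ v ∈ Icc t' t, SignType.sign (dq v) = SignType.sign (dp s) := fun v hv =>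
    (c.sign_deriv (h.convex_right h₃ h₁ hv.1 hv.2)).symm
  have hs₁ : s ∈ Icc s s' := left_mem_Icc.2 hs
  have hs₂ : s' ∈ Icc s s' := right_mem_Icc.2 hs
  have ht₁ : t' ∈ Icc t' t := left_mem_Icc.2 ht
  have ht₂ : t ∈ Icc t' t := right_mem_Icc.2 ht
  rcases le_total 0 (dp s) with hd | hd
  · have m₁ : MonotoneOn p (Icc s s') :=
      monotoneOn_of_hasDerivWithinAt_nonneg (convex_Icc _ _) c.cont_left.continuousOn
        (fun x _ => (c.deriv_left x).hasDerivWithinAt) fun x hx => by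
          rw [← sign_nonneg_iff, hp x (interior_subset hx), sign_nonneg_iff]; exact hd
    have m₂ : MonotoneOn q (Icc t' t) :=
      monotoneOn_of_hasDerivWithinAt_nonneg (convex_Icc _ _) c.cont_right.continuousOn
        (fun x _ => (c.deriv_right x).hasDerivWithinAt) fun x hx => by
          rw [← sign_nonneg_iff, hq x (interior_subset hx), sign_nonneg_iff]; exact hd
    exact le_antisymm (e₂ ▸ SignType.sign.monotone (m₁ hs₁ hs₂ hs))
      (e₁ ▸ SignType.sign.monotone (m₂ ht₁ ht₂ ht))
  · have m₁ : AntitoneOn p (Icc s s') :=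
      antitoneOn_of_hasDerivWithinAt_nonpos (convex_Icc _ _) c.cont_left.continuousOn
        (fun x _ => (c.deriv_left x).hasDerivWithinAt) fun x hx => by
          rw [← sign_nonpos_iff, hp x (interior_subset hx), sign_nonpos_iff]; exact hd
    have m₂ : AntitoneOn q (Icc t' t) :=
      antitoneOn_of_hasDerivWithinAt_nonpos (convex_Icc _ _) c.cont_right.continuousOn
        (fun x _ => (c.deriv_right x).hasDerivWithinAt) fun x hx => by
          rw [← sign_nonpos_iff, hq x (interior_subset hx), sign_nonpos_iff]; exact hd
    exact le_antisymm (e₁ ▸ SignType.sign.monotone (m₂ ht₁ ht₂ ht))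
      (e₂ ▸ SignType.sign.monotone (m₁ hs₁ hs₂ hs))

/-- The inductive step of the Cohen–Hörmander method. As critical points are already special, p and
q have nonzero derivative off the special points, and every sign of p on a cell also occurs for q on
the matched cell. -/
theorem refine_sign (h : CellCorrespondence Z W R) (c : Compatible Z R p dp q dq)
    (hp : Tendsto (fun t => |p t|) (cocompact ℝ) atTop)
    (hq : Tendsto (fun t => |q t|) (cocompact ℝ) atTop)
    (hdp : ∀ s, dp s = 0 → s ∈ Z) (hdq : ∀ t, dq t = 0 → t ∈ W)
    (hpf : {s | p s = 0}.Finite) (hqf : {t | q t = 0}.Finite) :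
    CellCorrespondence (Z ∪ {s | p s = 0}) (W ∪ {t | q t = 0})
      fun s t => R s t ∧ SignType.sign (p s) = SignType.sign (q t) where
  finite_left := h.finite_left.union hpf
  finite_right := h.finite_right.union hqf
  left_total := h.exists_sign_eq c hq hdp
  right_total t := by
    obtain ⟨s, hs, e⟩ := h.symm.exists_sign_eq (c.symm h) hp hdq t
    exact ⟨s, hs, e.symm⟩
  cross h₁ h₂ hs ht :=
    ⟨h.cross h₁.1 h₂.1 hs ht, h.sign_eq_of_cross c h₁.1 h₂.1 hs ht h₁.2 h₂.2⟩
  difun h₁ h₂ h₃ := ⟨h.difun h₁.1 h₂.1 h₃.1, h₁.2.trans (h₂.2.symm.trans h₃.2)⟩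
  fill_left h₁ hu := by
    refine ⟨h.fill_left h₁.1 fun u hm hZ => hu u hm (Or.inl hZ), ?_⟩
    rw [← h₁.2]
    exact (sign_eq_of_forall_uIcc_ne_zero c.cont_left fun u hm h₀ => hu u hm (Or.inr h₀)).symm
  fill_right h₁ hu := by
    refine ⟨h.fill_right h₁.1 fun u hm hZ => hu u hm (Or.inl hZ), ?_⟩
    rw [h₁.2]
    exact sign_eq_of_forall_uIcc_ne_zero c.cont_right fun u hm h₀ => hu u hm (Or.inr h₀)
  mem_iff {s t} h₁ := by
    have : p s = 0 ↔ q t = 0 := by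
      rw [← sign_eq_zero_iff, h₁.2, sign_eq_zero_iff]
    exact or_congr (h.mem_iff h₁.1) this

end CellCorrespondence

/-! ### Semialgebraic sets as unions of sign cells. -/

open Set Polynomial

section Semialgebraic

variable {ι : Type*}

lemma IsSemialgebraic.pos (p : MvPolynomial ι ℝ) :
    IsSemialgebraic {x : ι → ℝ | 0 < MvPolynomial.eval x p} :=
  BooleanSubalgebra.subset_closure ⟨p, rfl⟩

lemma IsSemialgebraic.compl {A : Set (ι → ℝ)} (hA : IsSemialgebraic A) : IsSemialgebraic Aᶜ :=
  BooleanSubalgebra.compl_mem hA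

lemma IsSemialgebraic.union {A B : Set (ι → ℝ)} (hA : IsSemialgebraic A)
    (hB : IsSemialgebraic B) : IsSemialgebraic (A ∪ B) :=
  BooleanSubalgebra.sup_mem hA hB

lemma IsSemialgebraic.inter {A B : Set (ι → ℝ)} (hA : IsSemialgebraic A)
    (hB : IsSemialgebraic B) : IsSemialgebraic (A ∩ B) :=
  BooleanSubalgebra.inf_mem hA hB

lemma IsSemialgebraic.sUnion {𝒜 : Set (Set (ι → ℝ))} (h𝒜 : 𝒜.Finite)
    (h : ∀ A ∈ 𝒜, IsSemialgebraic A) : IsSemialgebraic (⋃₀ 𝒜) :=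
  BooleanSubalgebra.sSup_mem h𝒜 h

lemma IsSemialgebraic.sInter {𝒜 : Set (Set (ι → ℝ))} (h𝒜 : 𝒜.Finite)
    (h : ∀ A ∈ 𝒜, IsSemialgebraic A) : IsSemialgebraic (⋂₀ 𝒜) :=
  BooleanSubalgebra.sInf_mem h𝒜 h

lemma IsSemialgebraic.iInter {κ : Type*} [Finite κ] {A : κ → Set (ι → ℝ)}
    (h : ∀ k, IsSemialgebraic (A k)) : IsSemialgebraic (⋂ k, A k) :=
  BooleanSubalgebra.iInf_mem h

lemma IsSemialgebraic.eq_zero (p : MvPolynomial ι ℝ) :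
    IsSemialgebraic {x : ι → ℝ | MvPolynomial.eval x p = 0} := by
  convert ((IsSemialgebraic.pos p).union (IsSemialgebraic.pos (-p))).compl using 1
  ext x
  simp only [mem_ofPred_eq, mem_compl_iff, mem_union, map_neg, Left.neg_pos_iff, not_or, not_lt]
  exact ⟨fun h => ⟨h.le, h.ge⟩, fun h => le_antisymm h.1 h.2⟩

/-- The family `𝒞` separates `A`: membership in `A` depends only on the memberships in the
sets of `𝒞`. -/
def Separates {X : Type*} (𝒞 : Set (Set X)) (A : Set X) : Prop :=
  ∀ x y, (∀ C ∈ 𝒞, x ∈ C ↔ y ∈ C) → (x ∈ A ↔ y ∈ A)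

/-- A separated set is the union of the atoms of `𝒞` that it contains, and a finite family has
finitely many atoms. -/
lemma IsSemialgebraic.of_separates {𝒞 : Set (Set (ι → ℝ))} (h𝒞 : 𝒞.Finite)
    (h : ∀ C ∈ 𝒞, IsSemialgebraic C) {A : Set (ι → ℝ)} (hA : Separates 𝒞 A) :
    IsSemialgebraic A := by
  classical
  let cell : Set (Set (ι → ℝ)) → Set (ι → ℝ) := fun 𝒟 => {y | ∀ C ∈ 𝒞, C ∈ 𝒟 ↔ y ∈ C}
  have hcell : ∀ 𝒟, IsSemialgebraic (cell 𝒟) := fun 𝒟 => by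
    have : cell 𝒟 = ⋂₀ ((fun C => if C ∈ 𝒟 then C else Cᶜ) '' 𝒞) := by
      ext y
      simp only [cell, mem_ofPred_eq, sInter_image, mem_iInter]
      refine forall₂_congr fun C _ => ?_
      by_cases hC : C ∈ 𝒟 <;> simp [hC]
    rw [this]
    refine IsSemialgebraic.sInter (h𝒞.image _) ?_
    rintro _ ⟨C, hC, rfl⟩
    by_cases hC' : C ∈ 𝒟
    · simpa [hC'] using h C hC
    · simpa [hC'] using (h C hC).compl
  have : A = ⋃₀ {S | ∃ 𝒟 ⊆ 𝒞, S = cell 𝒟 ∧ cell 𝒟 ⊆ A} := by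
    ext x
    refine ⟨fun hx => ⟨cell {C ∈ 𝒞 | x ∈ C}, ⟨_, sep_subset _ _, rfl, fun y hy => ?_⟩, ?_⟩, ?_⟩
    · refine (hA x y fun C hC => ?_).1 hx
      rw [← hy C hC]
      simp [hC]
    · intro C hC
      simp [hC]
    · rintro ⟨S, ⟨𝒟, _, rfl, hS⟩, hx⟩
      exact hS hx
  rw [this]
  refine IsSemialgebraic.sUnion (((h𝒞.finite_subsets).image cell).subset ?_) ?_
  · rintro S ⟨𝒟, h𝒟, rfl, _⟩
    exact ⟨𝒟, h𝒟, rfl⟩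
  · rintro S ⟨𝒟, _, rfl, _⟩
    exact hcell 𝒟

lemma IsSemialgebraic.exists_separates {A : Set (ι → ℝ)} (hA : IsSemialgebraic A) :
    ∃ P : Finset (MvPolynomial ι ℝ),
      Separates {B | ∃ p ∈ P, B = {x | 0 < MvPolynomial.eval x p}} A := by
  classical
  unfold IsSemialgebraic at hA
  induction hA using BooleanSubalgebra.closure_bot_sup_induction with
  | mem A hA =>
    obtain ⟨p, rfl⟩ := hA
    exact ⟨{p}, fun x y h => h _ ⟨p, by simp, rfl⟩⟩
  | bot => exact ⟨∅, fun x y _ => Iff.rfl⟩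
  | sup A _ B _ hA hB =>
    obtain ⟨P, hP⟩ := hA
    obtain ⟨Q, hQ⟩ := hB
    refine ⟨P ∪ Q, fun x y h => or_congr (hP x y ?_) (hQ x y ?_)⟩
    · rintro _ ⟨p, hp, rfl⟩
      exact h _ ⟨p, Finset.mem_union_left _ hp, rfl⟩
    · rintro _ ⟨p, hp, rfl⟩
      exact h _ ⟨p, Finset.mem_union_right _ hp, rfl⟩
  | compl A _ hA =>
    obtain ⟨P, hP⟩ := hA
    exact ⟨P, fun x y h => not_congr (hP x y h)⟩

lemma IsSemialgebraic.preimage {κ : Type*} {A : Set (κ → ℝ)} (hA : IsSemialgebraic A)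
    (f : κ → MvPolynomial ι ℝ) :
    IsSemialgebraic {x : ι → ℝ | (fun k => MvPolynomial.eval x (f k)) ∈ A} := by
  obtain ⟨P, hP⟩ := hA.exists_separates
  refine IsSemialgebraic.of_separates
    (𝒞 := (fun p => {x : ι → ℝ | 0 < MvPolynomial.eval x (MvPolynomial.bind₁ f p)}) '' (P : Set _))
    (P.finite_toSet.image _) ?_ fun x y h => hP _ _ ?_
  · rintro _ ⟨p, _, rfl⟩
    exact IsSemialgebraic.pos _
  · rintro _ ⟨p, hp, rfl⟩
    have key : ∀ z, MvPolynomial.eval z (MvPolynomial.bind₁ f p) =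
        MvPolynomial.eval (fun k => MvPolynomial.eval z (f k)) p :=
      fun z => MvPolynomial.eval₂Hom_bind₁ _ _ _ _
    have := h _ ⟨p, hp, rfl⟩
    simpa only [mem_ofPred_eq, key] using this

end Semialgebraic

/-! ### Polynomials with piecewise polynomial coefficients, and pseudo-division. -/

section Definable

variable {ι : Type*}

/-- Functions that are polynomial on each piece of a finite partition into semialgebraic sets. -/
inductive IsPiecewisePolynomial : ((ι → ℝ) → ℝ) → Prop
  | poly (p : MvPolynomial ι ℝ) : IsPiecewisePolynomial fun x => MvPolynomial.eval x p
  | ite {S : Set (ι → ℝ)} [DecidablePred (· ∈ S)] {f g : (ι → ℝ) → ℝ} (hS : IsSemialgebraic S)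
      (hf : IsPiecewisePolynomial f) (hg : IsPiecewisePolynomial g) :
      IsPiecewisePolynomial fun x => if x ∈ S then f x else g x

namespace IsPiecewisePolynomial

variable {f g : (ι → ℝ) → ℝ}

lemma const (c : ℝ) : IsPiecewisePolynomial fun _ : ι → ℝ => c := by
  simpa using poly (ι := ι) (MvPolynomial.C c)

lemma binary {op : ℝ → ℝ → ℝ}
    (hop : ∀ p q : MvPolynomial ι ℝ,
      IsPiecewisePolynomial fun x => op (MvPolynomial.eval x p) (MvPolynomial.eval x q))
    (hf : IsPiecewisePolynomial f) (hg : IsPiecewisePolynomial g) :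
    IsPiecewisePolynomial fun x => op (f x) (g x) := by
  induction hf with
  | poly p =>
    induction hg with
    | poly q => exact hop p q
    | ite hS _ _ h₁ h₂ =>
      convert ite hS h₁ h₂ using 2 with x
      dsimp only
      split_ifs <;> rfl
  | ite hS _ _ h₁ h₂ =>
    convert ite hS h₁ h₂ using 2 with x
    dsimp only
    split_ifs <;> rfl

lemma mul (hf : IsPiecewisePolynomial f) (hg : IsPiecewisePolynomial g) :
    IsPiecewisePolynomial fun x => f x * g x :=
  binary (fun p q => by simpa using poly (p * q)) hf hg

lemma sub (hf : IsPiecewisePolynomial f) (hg : IsPiecewisePolynomial g) :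
    IsPiecewisePolynomial fun x => f x - g x :=
  binary (fun p q => by simpa using poly (p - q)) hf hg

lemma isSemialgebraic_pos (hf : IsPiecewisePolynomial f) : IsSemialgebraic {x | 0 < f x} := by
  induction hf with
  | poly p => exact IsSemialgebraic.pos p
  | @ite S _ f g hS _ _ h₁ h₂ =>
    convert (hS.inter h₁).union (hS.compl.inter h₂) using 1
    ext x
    by_cases hx : x ∈ S <;> simp [hx]

lemma isSemialgebraic_neg (hf : IsPiecewisePolynomial f) : IsSemialgebraic {x | f x < 0} := by
  simpa using ((const 0).sub hf).isSemialgebraic_pos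

lemma isSemialgebraic_eq_zero (hf : IsPiecewisePolynomial f) : IsSemialgebraic {x | f x = 0} := by
  convert (hf.isSemialgebraic_pos.union hf.isSemialgebraic_neg).compl using 1
  ext x
  simp only [mem_ofPred_eq, mem_compl_iff, mem_union, not_or, not_lt]
  exact ⟨fun h => ⟨h.le, h.ge⟩, fun h => le_antisymm h.1 h.2⟩

end IsPiecewisePolynomial

/-- A family of real polynomials of bounded degree whose coefficients are piecewise polynomial
functions of the parameter. -/
structure IsDefinableFamily (F : (ι → ℝ) → ℝ[X]) : Prop where
  bounded : ∃ N : ℕ, ∀ x, (F x).degree < N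
  coeff : ∀ n, IsPiecewisePolynomial fun x => (F x).coeff n

namespace IsDefinableFamily

variable {F G : (ι → ℝ) → ℝ[X]}

lemma of_mvPolynomial (p : MvPolynomial (Option ι) ℝ) :
    IsDefinableFamily fun x => (MvPolynomial.optionEquivLeft ℝ ι p).map (MvPolynomial.eval x) where
  bounded := ⟨(MvPolynomial.optionEquivLeft ℝ ι p).natDegree + 1, fun x =>
    (degree_map_le.trans degree_le_natDegree).trans_lt (by exact_mod_cast Nat.lt_succ_self _)⟩
  coeff n := by
    simpa only [coeff_map] using IsPiecewisePolynomial.poly _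

lemma zero : IsDefinableFamily fun _ : ι → ℝ => (0 : ℝ[X]) where
  bounded := ⟨0, fun x => by simp⟩
  coeff n := by simpa using IsPiecewisePolynomial.const 0

lemma derivative (hF : IsDefinableFamily F) :
    IsDefinableFamily fun x => Polynomial.derivative (F x) where
  bounded := by
    obtain ⟨N, hN⟩ := hF.bounded
    exact ⟨N, fun x => (degree_derivative_le).trans_lt (hN x)⟩
  coeff n := by
    simpa only [coeff_derivative] using (hF.coeff (n + 1)).mul (IsPiecewisePolynomial.const _)

lemma ite {S : Set (ι → ℝ)} [DecidablePred (· ∈ S)] (hS : IsSemialgebraic S)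
    (hF : IsDefinableFamily F) (hG : IsDefinableFamily G) :
    IsDefinableFamily fun x => if x ∈ S then F x else G x where
  bounded := by
    obtain ⟨N, hN⟩ := hF.bounded
    obtain ⟨M, hM⟩ := hG.bounded
    refine ⟨max N M, fun x => ?_⟩
    split_ifs
    · exact (hN x).trans_le (by exact_mod_cast le_max_left _ _)
    · exact (hM x).trans_le (by exact_mod_cast le_max_right _ _)
  coeff n := by
    convert IsPiecewisePolynomial.ite hS (hF.coeff n) (hG.coeff n) using 2 with x
    split_ifs <;> rfl

lemma sub (hF : IsDefinableFamily F) (hG : IsDefinableFamily G) :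
    IsDefinableFamily fun x => F x - G x where
  bounded := by
    obtain ⟨N, hN⟩ := hF.bounded
    obtain ⟨M, hM⟩ := hG.bounded
    refine ⟨max N M, fun x => (degree_sub_le _ _).trans_lt (max_lt ?_ ?_)⟩
    · exact (hN x).trans_le (by exact_mod_cast le_max_left _ _)
    · exact (hM x).trans_le (by exact_mod_cast le_max_right _ _)
  coeff n := by simpa only [coeff_sub] using (hF.coeff n).sub (hG.coeff n)

lemma C_mul {a : (ι → ℝ) → ℝ} (ha : IsPiecewisePolynomial a) (hF : IsDefinableFamily F) :
    IsDefinableFamily fun x => C (a x) * F x where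
  bounded := by
    obtain ⟨N, hN⟩ := hF.bounded
    exact ⟨N, fun x => by
      rw [← smul_eq_C_mul]
      exact (degree_smul_le _ _).trans_lt (hN x)⟩
  coeff n := by simpa only [coeff_C_mul] using ha.mul (hF.coeff n)

lemma X_pow_mul (k : ℕ) (hF : IsDefinableFamily F) :
    IsDefinableFamily fun x => X ^ k * F x where
  bounded := by
    obtain ⟨N, hN⟩ := hF.bounded
    refine ⟨k + N, fun x => ?_⟩
    rw [degree_lt_iff_coeff_zero]
    intro m hm
    rw [coeff_X_pow_mul']
    split_ifs
    · exact coeff_eq_zero_of_degree_lt ((hN x).trans_le (by exact_mod_cast by omega))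
    · rfl
  coeff n := by
    simp only [coeff_X_pow_mul']
    split_ifs
    · exact hF.coeff _
    · exact IsPiecewisePolynomial.const 0

end IsDefinableFamily

/-- One step of pseudo-division, with the square of the leading coefficient as multiplier. -/
lemma degree_pseudoDivision_lt {p g : ℝ[X]} {M N : ℕ} (hMN : M ≤ N) (hg : g.degree < (M + 1 : ℕ))
    (hp : p.degree < (N + 1 : ℕ)) :
    (C (g.coeff M * g.coeff M) * p - C (g.coeff M * p.coeff N) * (X ^ (N - M) * g)).degree <
      (N : WithBot ℕ) := by
  rw [degree_lt_iff_coeff_zero] at hg hp ⊢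
  intro n hn
  rw [coeff_sub, coeff_C_mul, coeff_C_mul, coeff_X_pow_mul', if_pos (by omega)]
  rcases hn.eq_or_lt with rfl | hn
  · rw [Nat.sub_sub_self hMN]; ring
  · rw [hp n hn, hg (n - (N - M)) (by omega)]; ring

/-- The multiplier is a nonzero square, so it does not disturb signs at the zeros of g. -/
lemma sign_eval_pseudoDivision {p g : ℝ[X]} {M N : ℕ} (h : g.coeff M ≠ 0) {z : ℝ}
    (hz : g.eval z = 0) :
    SignType.sign ((C (g.coeff M * g.coeff M) * p -
      C (g.coeff M * p.coeff N) * (X ^ (N - M) * g)).eval z) = SignType.sign (p.eval z) := by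
  simp only [eval_sub, eval_mul, eval_C, hz, mul_zero, sub_zero, sign_mul]
  rw [← sign_mul, sign_pos (mul_self_pos.2 h), one_mul]

lemma IsDefinableFamily.exists_pseudoRemainder_of_coeff_ne_zero {G : (ι → ℝ) → ℝ[X]}
    (hG : IsDefinableFamily G) {M : ℕ} (hM : ∀ x, (G x).degree < (M + 1 : ℕ)) (N : ℕ)
    {F : (ι → ℝ) → ℝ[X]} (hF : IsDefinableFamily F) (hN : ∀ x, (F x).degree < N) :
    ∃ r : (ι → ℝ) → ℝ[X], IsDefinableFamily r ∧ ∀ x, (G x).coeff M ≠ 0 → (r x).degree < M ∧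
      ∀ z, (G x).eval z = 0 → SignType.sign ((r x).eval z) = SignType.sign ((F x).eval z) := by
  classical
  induction N generalizing F with
  | zero =>
    exact ⟨F, hF, fun x _ => ⟨(hN x).trans_le (by exact_mod_cast Nat.zero_le M), fun _ _ => rfl⟩⟩
  | succ N ih =>
    by_cases hNM : N + 1 ≤ M
    · exact ⟨F, hF, fun x _ => ⟨(hN x).trans_le (by exact_mod_cast hNM), fun _ _ => rfl⟩⟩
    obtain ⟨r, hr, h⟩ := ih (((hF.C_mul ((hG.coeff M).mul (hG.coeff M))).sub
      ((hG.X_pow_mul (N - M)).C_mul ((hG.coeff M).mul (hF.coeff N)))))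
      fun x => degree_pseudoDivision_lt (by omega) (hM x) (hN x)
    refine ⟨r, hr, fun x hx => ⟨(h x hx).1, fun z hz => ?_⟩⟩
    rw [(h x hx).2 z hz, sign_eval_pseudoDivision hx hz]

/-- The degree of `G x` varies with x, so the argument descends on a formal degree bound. Where the
top coefficient is nonzero, pseudo-division applies; where it vanishes, the bound drops by one. -/
lemma IsDefinableFamily.exists_pseudoRemainder {F G : (ι → ℝ) → ℝ[X]}
    (hF : IsDefinableFamily F) (hG : IsDefinableFamily G) :
    ∃ r : (ι → ℝ) → ℝ[X], IsDefinableFamily r ∧ ∀ x, (G x = 0 → r x = 0) ∧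
      (G x ≠ 0 → (r x).degree < (G x).degree ∧
        ∀ z, (G x).eval z = 0 → SignType.sign ((r x).eval z) = SignType.sign ((F x).eval z)) := by
  classical
  obtain ⟨M, hM⟩ := hG.bounded
  induction M generalizing G with
  | zero =>
    have hG₀ : ∀ x, G x = 0 := fun x => by simpa using hM x
    exact ⟨_, IsDefinableFamily.zero, fun x => ⟨fun _ => rfl, fun h => absurd (hG₀ x) h⟩⟩
  | succ M ih =>
    have hS := (hG.coeff M).isSemialgebraic_eq_zero
    -- Off the vanishing locus the divisor is set to 0 merely to satisfy the smaller bound; `r₁` is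
    -- not used there.
    obtain ⟨r₁, hr₁, h₁⟩ := ih (hG.ite hS IsDefinableFamily.zero) fun x => by
      split_ifs with hx
      · rw [degree_lt_iff_coeff_zero]
        intro m hm
        rcases hm.eq_or_lt with rfl | hm
        · exact hx
        · exact coeff_eq_zero_of_degree_lt ((hM x).trans_le (by exact_mod_cast hm))
      · simp
    obtain ⟨N, hN⟩ := hF.bounded
    obtain ⟨r₂, hr₂, h₂⟩ := hG.exists_pseudoRemainder_of_coeff_ne_zero hM N hF hN
    refine ⟨_, hr₁.ite hS hr₂, fun x => ?_⟩
    have h₁ := h₁ x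
    by_cases hx : x ∈ {x | (G x).coeff M = 0}
    · simpa only [if_pos hx] using h₁
    · have hx' : (G x).coeff M ≠ 0 := hx
      simp only [if_neg hx]
      refine ⟨fun h₀ => absurd (by simp [h₀]) hx', fun _ => ⟨?_, (h₂ x hx').2⟩⟩
      exact (h₂ x hx').1.trans_le (le_degree_of_ne_zero hx')

end Definable

/-! ### Finitely many semialgebraic conditions determine the sign pattern of a list. -/

open Set Polynomial Filter

section Classification

variable {ι : Type*}

/-- The zeros of the nonzero members of the specialisation of `L` at `x`. -/
def specialPoints (L : Finset ((ι → ℝ) → ℝ[X])) (x : ι → ℝ) : Set ℝ :=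
  {s | ∃ F ∈ L, F x ≠ 0 ∧ (F x).eval s = 0}

/-- A correspondence between the cell decompositions defined by `L` at `x` and at `y`, preserving
the signs of all members of `L`. -/
structure Matching (L : Finset ((ι → ℝ) → ℝ[X])) (x y : ι → ℝ) (R : ℝ → ℝ → Prop) : Prop where
  cells : CellCorrespondence (specialPoints L x) (specialPoints L y) R
  sign_eq : ∀ F ∈ L, ∀ {s t}, R s t →
    SignType.sign ((F x).eval s) = SignType.sign ((F y).eval t)

/-- Finitely many semialgebraic sets decide which parameters have matching specialisations. -/
def IsClassified (L : Finset ((ι → ℝ) → ℝ[X])) : Prop :=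
  ∃ 𝒞 : Set (Set (ι → ℝ)), 𝒞.Finite ∧ (∀ C ∈ 𝒞, IsSemialgebraic C) ∧
    ∀ x y, (∀ C ∈ 𝒞, x ∈ C ↔ y ∈ C) → ∃ R, Matching L x y R

lemma finite_eval_eq_zero {p : ℝ[X]} (hp : p ≠ 0) : {s | p.eval s = 0}.Finite :=
  p.rootSet_finite ℝ |>.subset fun s hs => by
    rw [mem_rootSet]
    exact ⟨hp, by simpa using hs⟩

lemma Matching.eq_zero {L : Finset ((ι → ℝ) → ℝ[X])} {x y : ι → ℝ} {R : ℝ → ℝ → Prop}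
    (h : Matching L x y R) {F : (ι → ℝ) → ℝ[X]} (hF : F ∈ L) (h₀ : F x = 0) : F y = 0 := by
  refine Polynomial.funext fun t => ?_
  obtain ⟨s, hs⟩ := h.cells.right_total t
  have := h.sign_eq F hF hs
  rw [h₀, eval_zero, sign_zero] at this
  rw [eval_zero]
  exact sign_eq_zero_iff.1 this.symm

lemma Matching.symm {L : Finset ((ι → ℝ) → ℝ[X])} {x y : ι → ℝ} {R : ℝ → ℝ → Prop}
    (h : Matching L x y R) : Matching L y x fun t s => R s t where
  cells := h.cells.symm
  sign_eq F hF _ _ hR := (h.sign_eq F hF hR).symm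

lemma specialPoints_insert [DecidableEq ((ι → ℝ) → ℝ[X])] (L : Finset ((ι → ℝ) → ℝ[X]))
    (v : (ι → ℝ) → ℝ[X]) (x : ι → ℝ) :
    specialPoints (insert v L) x = specialPoints L x ∪ {s | v x ≠ 0 ∧ (v x).eval s = 0} := by
  ext s
  simp [specialPoints, or_comm]

lemma tendsto_abs_eval_of_derivative_ne_zero {p : ℝ[X]} (hp : derivative p ≠ 0) :
    Tendsto (fun t => |p.eval t|) (cocompact ℝ) atTop :=
  p.tendsto_norm_atTop (by
    by_contra! h
    exact hp (by rw [eq_C_of_degree_le_zero h, derivative_C])) (tendsto_norm_cocompact_atTop)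

/-- `r` has the same sign as `v` at the zeros of the nonzero specialisations of `g`. -/
def AgreesAtZeros (v g r : (ι → ℝ) → ℝ[X]) : Prop :=
  ∀ x, g x ≠ 0 → ∀ z, (g x).eval z = 0 →
    SignType.sign ((r x).eval z) = SignType.sign ((v x).eval z)

/-- If the derivative of `v x` vanishes, so does that of `v y`; both are constants, add no special
point, and have the sign of their constant coefficient. Otherwise both are nonconstant and
`refine_sign` applies. -/
lemma Matching.insert [DecidableEq ((ι → ℝ) → ℝ[X])] {L : Finset ((ι → ℝ) → ℝ[X])}
    {x y : ι → ℝ} {R : ℝ → ℝ → Prop} (h : Matching L x y R) {v : (ι → ℝ) → ℝ[X]}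
    (hd : (fun x => derivative (v x)) ∈ L) (hr : ∀ g ∈ L, ∃ r ∈ L, AgreesAtZeros v g r)
    (h₀ : SignType.sign ((v x).coeff 0) = SignType.sign ((v y).coeff 0)) :
    ∃ R, Matching (insert v L) x y R := by
  by_cases hx : derivative (v x) = 0
  · have hy : derivative (v y) = 0 := h.eq_zero hd hx
    have ex := eq_C_of_derivative_eq_zero hx
    have ey := eq_C_of_derivative_eq_zero hy
    have key : ∀ z, derivative (v z) = 0 →
        specialPoints (Insert.insert v L) z = specialPoints L z := fun z hz => by
      rw [specialPoints_insert, union_eq_left]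
      rintro s ⟨h₁, h₂⟩
      rw [eq_C_of_derivative_eq_zero hz, eval_C] at h₂
      exact absurd (by rw [eq_C_of_derivative_eq_zero hz, h₂, C_0]) h₁
    refine ⟨R, ⟨by rw [key x hx, key y hy]; exact h.cells, fun F hF s t hR => ?_⟩⟩
    rcases Finset.mem_insert.1 hF with rfl | hF
    · rw [ex, ey, eval_C, eval_C, h₀]
    · exact h.sign_eq F hF hR
  · have hy : derivative (v y) ≠ 0 := fun hy => hx (h.symm.eq_zero hd hy)
    have ne : ∀ z, derivative (v z) ≠ 0 → v z ≠ 0 := fun z hz e => hz (by rw [e, derivative_zero])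
    have key : ∀ z, derivative (v z) ≠ 0 → specialPoints (Insert.insert v L) z =
        specialPoints L z ∪ {s | (v z).eval s = 0} := fun z hz => by
      simp [specialPoints_insert, ne z hz]
    have c : CellCorrespondence.Compatible (specialPoints L x) R (fun s => (v x).eval s)
        (fun s => (derivative (v x)).eval s) (fun s => (v y).eval s)
        (fun s => (derivative (v y)).eval s) :=
      { deriv_left := (v x).hasDerivAt
        deriv_right := (v y).hasDerivAt
        continuous_left := (derivative (v x)).continuous
        continuous_right := (derivative (v y)).continuous
        sign_deriv := fun hR => h.sign_eq _ hd hR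
        -- A special point is a zero of some g in L, and its partner is a zero of g as well; there v
        -- has the sign of a remainder that L already controls.
        sign_special := by
          rintro s t hR ⟨g, hg, hgx, hgs⟩
          obtain ⟨r, hrL, hrg⟩ := hr g hg
          have hgy : g y ≠ 0 := fun hgy => hgx (h.symm.eq_zero hg hgy)
          have hgt : (g y).eval t = 0 := by
            rw [← sign_eq_zero_iff, ← h.sign_eq g hg hR, hgs, sign_zero]
          rw [← hrg x hgx s hgs, ← hrg y hgy t hgt]
          exact h.sign_eq r hrL hR }
    have := h.cells.refine_sign c (tendsto_abs_eval_of_derivative_ne_zero hx)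
      (tendsto_abs_eval_of_derivative_ne_zero hy) (fun s hs => ⟨_, hd, hx, hs⟩)
      (fun t ht => ⟨_, hd, hy, ht⟩) (finite_eval_eq_zero (ne x hx)) (finite_eval_eq_zero (ne y hy))
    refine ⟨_, ⟨by rw [key x hx, key y hy]; exact this, fun F hF s t hR => ?_⟩⟩
    rcases Finset.mem_insert.1 hF with rfl | hF
    · exact hR.2
    · exact h.sign_eq F hF hR.1

lemma IsClassified.insert [DecidableEq ((ι → ℝ) → ℝ[X])] {L : Finset ((ι → ℝ) → ℝ[X])}
    (h : IsClassified L) {v : (ι → ℝ) → ℝ[X]} (hv : IsDefinableFamily v)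
    (hd : (fun x => derivative (v x)) ∈ L) (hr : ∀ g ∈ L, ∃ r ∈ L, AgreesAtZeros v g r) :
    IsClassified (insert v L) := by
  obtain ⟨𝒞, hfin, hsa, h𝒞⟩ := h
  refine ⟨Insert.insert {x | 0 < (v x).coeff 0} (Insert.insert {x | (v x).coeff 0 < 0} 𝒞),
    (hfin.insert _).insert _, ?_, fun x y hxy => ?_⟩
  · rintro C (rfl | rfl | hC)
    · exact (hv.coeff 0).isSemialgebraic_pos
    · exact (hv.coeff 0).isSemialgebraic_neg
    · exact hsa C hC
  · obtain ⟨R, hR⟩ := h𝒞 x y fun C hC => hxy C (Or.inr (Or.inr hC))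
    refine hR.insert hd hr ?_
    have h₁ : 0 < (v x).coeff 0 ↔ 0 < (v y).coeff 0 := hxy _ (Or.inl rfl)
    have h₂ : (v x).coeff 0 < 0 ↔ (v y).coeff 0 < 0 := hxy _ (Or.inr (Or.inl rfl))
    simp only [sign_apply, h₁, h₂]

lemma isClassified_of_forall_eq_zero {L : Finset ((ι → ℝ) → ℝ[X])}
    (hL : ∀ F ∈ L, ∀ x, F x = 0) : IsClassified L := by
  refine ⟨∅, finite_empty, by simp, fun x y _ => ⟨fun _ _ => True, ?_, fun F hF s t _ => ?_⟩⟩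
  · have : ∀ z, specialPoints L z = ∅ := fun z =>
      eq_empty_of_forall_notMem fun s ⟨F, hF, hz, _⟩ => hz (hL F hF z)
    rw [this, this]
    constructor <;> simp
  · rw [hL F hF, hL F hF, eval_zero, eval_zero]

/-- Every finite set of definable families lies in a classified one, closed under derivatives and
pseudo-remainders. -/
theorem exists_isClassified (d : ℕ) (U V : Finset ((ι → ℝ) → ℝ[X]))
    (hU : ∀ F ∈ U, IsDefinableFamily F) (hV : ∀ F ∈ V, IsDefinableFamily F)
    (hd : ∀ F ∈ V, ∀ x, (F x).degree < d) :
    ∃ L : Finset ((ι → ℝ) → ℝ[X]), V ⊆ L ∧ IsClassified L ∧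
      ∀ v ∈ U, ∀ g ∈ L, ∃ r ∈ L, AgreesAtZeros v g r := by
  classical
  induction d generalizing U V with
  | zero =>
    have h₀ : ∀ F ∈ V, ∀ x, F x = 0 := fun F hF x => by simpa using hd F hF x
    have h₁ : ∀ F ∈ insert (fun _ => 0) V, ∀ x, F x = 0 := fun F hF x => by
      rcases Finset.mem_insert.1 hF with rfl | hF
      · rfl
      · exact h₀ F hF x
    exact ⟨insert (fun _ => 0) V, Finset.subset_insert _ _, isClassified_of_forall_eq_zero h₁,
      fun v _ g hg => ⟨g, hg, fun x hx => absurd (h₁ g hg x) hx⟩⟩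
  | succ d ih =>
    let rem : ((ι → ℝ) → ℝ[X]) → ((ι → ℝ) → ℝ[X]) → (ι → ℝ) → ℝ[X] := fun F G =>
      if h : IsDefinableFamily F ∧ IsDefinableFamily G then
        (h.1.exists_pseudoRemainder h.2).choose else F
    have hrem : ∀ F G, IsDefinableFamily F → IsDefinableFamily G → IsDefinableFamily (rem F G) ∧
        ∀ x, (G x = 0 → rem F G x = 0) ∧ (G x ≠ 0 → (rem F G x).degree < (G x).degree ∧
          ∀ z, (G x).eval z = 0 →
            SignType.sign ((rem F G x).eval z) = SignType.sign ((F x).eval z)) := by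
      intro F G hF hG
      simp only [rem, dif_pos (And.intro hF hG)]
      exact (hF.exists_pseudoRemainder hG).choose_spec
    have hUV : ∀ F ∈ U ∪ V, IsDefinableFamily F := fun F hF =>
      (Finset.mem_union.1 hF).elim (hU F) (hV F)
    -- Derivatives of V and remainders modulo V have smaller degree. The set U, of no bounded
    -- degree, collects the families whose remainders modulo everything of lower degree will be
    -- needed; V joins it on the way down.
    obtain ⟨L, hL, hcl, hr⟩ := ih (U ∪ V)
      ((V.image fun F x => derivative (F x)) ∪ Finset.image₂ rem (U ∪ V) V) hUV
      (by
        intro F hF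
        rcases Finset.mem_union.1 hF with hF | hF
        · obtain ⟨G, hG, rfl⟩ := Finset.mem_image.1 hF
          exact (hV G hG).derivative
        · obtain ⟨F, hFU, G, hG, rfl⟩ := Finset.mem_image₂.1 hF
          exact (hrem F G (hUV F hFU) (hV G hG)).1)
      (by
        have key : ∀ {p q : ℝ[X]}, p.degree < (d + 1 : ℕ) → q.degree < p.degree →
            q.degree < (d : WithBot ℕ) := fun {p q} hp hq => by
          rw [degree_lt_iff_coeff_zero] at hp
          exact hq.trans_le ((degree_le_iff_coeff_zero _ _).2 fun k hk =>
            hp k (by exact_mod_cast hk))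
        intro F hF x
        rcases Finset.mem_union.1 hF with hF | hF
        · obtain ⟨G, hG, rfl⟩ := Finset.mem_image.1 hF
          by_cases h₀ : G x = 0
          · simp [h₀]
          · exact key (hd G hG x) (degree_derivative_lt h₀)
        · obtain ⟨F, hFU, G, hG, rfl⟩ := Finset.mem_image₂.1 hF
          have := (hrem F G (hUV F hFU) (hV G hG)).2 x
          by_cases h₀ : G x = 0
          · simp [this.1 h₀]
          · exact key (hd G hG x) (this.2 h₀).1)
    have hr' : ∀ v ∈ U ∪ V, ∀ g ∈ L ∪ V, ∃ r ∈ L, AgreesAtZeros v g r := fun v hv g hg => by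
      rcases Finset.mem_union.1 hg with hg | hg
      · exact hr v hv g hg
      · exact ⟨rem v g, hL (Finset.mem_union_right _ (Finset.mem_image₂_of_mem hv hg)),
          fun x hx => (((hrem v g (hUV v hv) (hV g hg)).2 x).2 hx).2⟩
    -- The members of V can be added one at a time in any order: the required derivatives and
    -- remainders, also those modulo other members of V, are already in L.
    have hstep : ∀ A ⊆ V, IsClassified (A ∪ L) := fun A => by
      induction A using Finset.induction_on with
      | empty => intro _; simpa using hcl
      | insert v A _ ihA =>
        intro hA
        have hv : v ∈ V := hA (Finset.mem_insert_self _ _)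
        have hAV : A ⊆ V := (Finset.subset_insert _ _).trans hA
        rw [Finset.insert_union]
        refine (ihA hAV).insert (hV v hv) (Finset.mem_union_right _
          (hL (Finset.mem_union_left _ (Finset.mem_image_of_mem _ hv)))) fun g hg => ?_
        obtain ⟨r, hrL, h⟩ := hr' v (Finset.mem_union_right _ hv) g
          (by
            rcases Finset.mem_union.1 hg with hg | hg
            · exact Finset.mem_union_right _ (hAV hg)
            · exact Finset.mem_union_left _ hg)
        exact ⟨r, Finset.mem_union_right _ hrL, h⟩
    refine ⟨V ∪ L, Finset.subset_union_left, hstep V (Finset.Subset.refl _), fun v hv g hg => ?_⟩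
    obtain ⟨r, hrL, h⟩ := hr' v (Finset.mem_union_left _ hv) g (by rwa [Finset.union_comm])
    exact ⟨r, Finset.mem_union_right _ hrL, h⟩

end Classification

/-! ### Tarski–Seidenberg projection. -/

section Projection

variable {ι : Type*}

/-- The projection of a semialgebraic set along one coordinate is semialgebraic. -/
theorem IsSemialgebraic.exists_option {A : Set (Option ι → ℝ)} (hA : IsSemialgebraic A) :
    IsSemialgebraic {x : ι → ℝ | ∃ t : ℝ, (fun o : Option ι => o.elim t x) ∈ A} := by
  classical
  obtain ⟨P, hP⟩ := hA.exists_separates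
  let fam : MvPolynomial (Option ι) ℝ → (ι → ℝ) → ℝ[X] := fun p x =>
    (MvPolynomial.optionEquivLeft ℝ ι p).map (MvPolynomial.eval x)
  have hfam : ∀ F ∈ P.image fam, IsDefinableFamily F := fun F hF => by
    obtain ⟨p, _, rfl⟩ := Finset.mem_image.1 hF
    exact IsDefinableFamily.of_mvPolynomial p
  have hbound : ∃ d : ℕ, ∀ F ∈ P.image fam, ∀ x, (F x).degree < d := by
    choose! N hN using fun F hF => (hfam F hF).bounded
    exact ⟨(P.image fam).sup N, fun F hF x => (hN F hF x).trans_le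
      (by exact_mod_cast Finset.le_sup (f := N) hF)⟩
  obtain ⟨d, hd⟩ := hbound
  obtain ⟨L, hL, ⟨𝒞, hfin, hsa, h𝒞⟩, _⟩ := exists_isClassified d ∅ (P.image fam) (by simp) hfam hd
  have key : ∀ x y, (∀ C ∈ 𝒞, x ∈ C ↔ y ∈ C) →
      (∃ t : ℝ, (fun o : Option ι => o.elim t x) ∈ A) →
      ∃ t : ℝ, (fun o : Option ι => o.elim t y) ∈ A := by
    rintro x y hxy ⟨s, hs⟩
    obtain ⟨R, hR⟩ := h𝒞 x y hxy
    -- A partner t of the witness s gives every defining polynomial the same sign at y as s does at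
    -- x.
    obtain ⟨t, ht⟩ := hR.cells.left_total s
    refine ⟨t, (hP _ _ ?_).1 hs⟩
    rintro _ ⟨p, hp, rfl⟩
    have := hR.sign_eq (fam p) (hL (Finset.mem_image_of_mem _ hp)) ht
    rw [mem_ofPred_eq, mem_ofPred_eq, MvPolynomial.optionEquivLeft_elim_eval,
      MvPolynomial.optionEquivLeft_elim_eval, ← sign_eq_one_iff, ← sign_eq_one_iff]
    exact this ▸ Iff.rfl
  exact IsSemialgebraic.of_separates hfin hsa fun x y hxy =>
    ⟨key x y hxy, key y x fun C hC => (hxy C hC).symm⟩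

/-- **Tarski–Seidenberg**: projections of semialgebraic sets are semialgebraic. -/
theorem IsSemialgebraic.exists_sum (κ : Type*) [Finite κ] {A : Set (ι ⊕ κ → ℝ)}
    (hA : IsSemialgebraic A) : IsSemialgebraic {x : ι → ℝ | ∃ y : κ → ℝ, Sum.elim x y ∈ A} := by
  induction κ using Finite.induction_empty_option with
  | @of_equiv α β e ih =>
    convert ih (hA.preimage (Sum.elim (fun i => MvPolynomial.X (Sum.inl i))
      fun b => MvPolynomial.X (Sum.inr (e.symm b)))) using 1
    ext x
    refine (e.symm.arrowCongr (Equiv.refl ℝ)).exists_congr fun y => ?_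
    simp only [mem_ofPred_eq]
    refine iff_of_eq (congrArg (· ∈ A) (funext fun j => ?_))
    rcases j with i | b <;> simp [Equiv.arrowCongr]
  | h_empty =>
    convert hA.preimage (Sum.elim (fun i => MvPolynomial.X i) fun b => b.elim) using 1
    ext x
    have : ∀ y : PEmpty → ℝ, Sum.elim x y ∈ A ↔ (fun k => MvPolynomial.eval x
        (Sum.elim (fun i => MvPolynomial.X i) (fun b : PEmpty => b.elim) k)) ∈ A := fun y =>
      iff_of_eq (congrArg (· ∈ A) (funext fun j => by
        rcases j with i | b
        · simp
        · exact b.elim))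
    simp only [mem_ofPred_eq, this, exists_const]
  | @h_option α _ ih =>
    have h₁ := hA.preimage (ι := Option (ι ⊕ α)) (Sum.elim
      (fun i => MvPolynomial.X (some (Sum.inl i)))
      fun b => MvPolynomial.X (b.map Sum.inr))
    convert ih h₁.exists_option using 1
    ext x
    simp only [mem_ofPred_eq]
    have key : ∀ (y : α → ℝ) (t : ℝ), (fun k => MvPolynomial.eval
        (fun o : Option (ι ⊕ α) => o.elim t (Sum.elim x y))
        ((Sum.elim (fun i => MvPolynomial.X (some (Sum.inl i)))
          fun b : Option α => MvPolynomial.X (b.map Sum.inr) :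
            ι ⊕ Option α → MvPolynomial (Option (ι ⊕ α)) ℝ) k)) =
        Sum.elim x (fun b : Option α => b.elim t y) := fun y t => by
      funext k
      rcases k with i | _ | b <;> simp
    constructor
    · rintro ⟨y, hy⟩
      refine ⟨fun a => y (some a), y none, ?_⟩
      rw [key]
      convert hy using 2
      funext b
      cases b <;> rfl
    · rintro ⟨y, t, h⟩
      rw [key] at h
      exact ⟨_, h⟩

end Projection

/-! ### The image of the parametrization. -/

open Set

section Image

variable {m : ℕ} {Δ : Finset (Finset (Fin m))}

lemma phi_apply (γ : Param Δ) (i j : Fin m) : phi Δ γ i j = ∑ F, Gam γ i F * Gam γ j F := rfl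

lemma Gam_eq_zero (γ : Param Δ) {i : Fin m} {F : {F : Finset (Fin m) // F ∈ Δ}} (h : i ∉ F.1) :
    Gam γ i F = 0 := dif_neg h

lemma isSymm_phi (γ : Param Δ) : (phi Δ γ).IsSymm :=
  Matrix.IsSymm.ext fun i j => by simp only [phi_apply, mul_comm]

lemma phi_apply_eq_zero (hΔ : IsSimplicialComplexOn Δ) (γ : Param Δ) {i j : Fin m} (hij : i ≠ j)
    (h : ¬ (underlyingGraph Δ).Adj i j) : phi Δ γ i j = 0 := by
  rw [phi_apply]
  refine Finset.sum_eq_zero fun F _ => ?_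
  by_cases hi : i ∈ F.1
  · by_cases hj : j ∈ F.1
    · refine absurd ⟨hij, hΔ.down_closed F.1 F.2 _ fun k hk => ?_⟩ h
      rcases Finset.mem_insert.1 hk with rfl | hk
      · exact hi
      · rwa [Finset.mem_singleton.1 hk]
    · rw [Gam_eq_zero γ hj, mul_zero]
  · rw [Gam_eq_zero γ hi, zero_mul]

lemma range_phi_subset_symSpace (hΔ : IsSimplicialComplexOn Δ) :
    range (phi Δ) ⊆ symSpace (underlyingGraph Δ) := by
  rintro _ ⟨γ, rfl⟩
  exact ⟨isSymm_phi γ, fun i j hij h => phi_apply_eq_zero hΔ γ hij h⟩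

lemma range_phi_subset_psdCone (hΔ : IsSimplicialComplexOn Δ) :
    range (phi Δ) ⊆ psdCone (underlyingGraph Δ) := by
  rintro _ ⟨γ, rfl⟩
  refine ⟨range_phi_subset_symSpace hΔ ⟨γ, rfl⟩, ?_⟩
  have := Matrix.posSemidef_self_mul_conjTranspose (Gam γ)
  rwa [Matrix.conjTranspose_eq_transpose_of_trivial] at this

lemma continuous_Gam_apply (i : Fin m) (F : {F : Finset (Fin m) // F ∈ Δ}) :
    Continuous fun γ : Param Δ => Gam γ i F := by
  by_cases h : i ∈ F.1
  · simp only [Gam, Matrix.of_apply, dif_pos h]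
    fun_prop
  · simp only [Gam_eq_zero _ h]
    fun_prop

lemma continuous_phi : Continuous (phi Δ) := by
  refine continuous_matrix fun i j => ?_
  simp only [phi_apply]
  exact continuous_finsetSum _ fun F _ =>
    (continuous_Gam_apply i F).mul (continuous_Gam_apply j F)

lemma sq_le_trace_phi (γ : Param Δ) (F : {F : Finset (Fin m) // F ∈ Δ}) (i : {i // i ∈ F.1}) :
    γ F i ^ 2 ≤ (phi Δ γ).trace := by
  have h₁ : γ F i ^ 2 = Gam γ i F * Gam γ i F := by
    simp only [Gam, Matrix.of_apply, dif_pos i.2, sq]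
  have h₂ : ∀ j, 0 ≤ phi Δ γ j j := fun j => Finset.sum_nonneg fun F _ => mul_self_nonneg _
  calc γ F i ^ 2 ≤ phi Δ γ i i := by
        rw [h₁, phi_apply]
        exact Finset.single_le_sum (f := fun F => Gam γ i F * Gam γ i F)
          (fun F _ => mul_self_nonneg _) (Finset.mem_univ F)
    _ ≤ (phi Δ γ).trace :=
        Finset.single_le_sum (f := fun j => phi Δ γ j j) (fun j _ => h₂ j)
          (Finset.mem_univ (i : Fin m))

/-- On the preimage of a compact set the trace is bounded by some M, so the parameters lie in the
box with sides [-√M, √M]. Hence the map is proper. -/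
lemma isClosed_range_phi : IsClosed (range (phi Δ)) := by
  have : WeaklyLocallyCompactSpace (Matrix (Fin m) (Fin m) ℝ) :=
    inferInstanceAs (WeaklyLocallyCompactSpace (Fin m → Fin m → ℝ))
  refine (isProperMap_iff_isCompact_preimage.2
    ⟨continuous_phi, fun K hK => ?_⟩).isClosedMap.isClosed_range
  obtain ⟨M, hM⟩ := hK.bddAbove_image (f := Matrix.trace)
    (Continuous.matrix_trace continuous_id).continuousOn
  refine (isCompact_univ_pi fun F => isCompact_univ_pi fun i =>
    isCompact_Icc (a := -√M) (b := √M)).of_isClosed_subset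
      (hK.isClosed.preimage continuous_phi) fun γ hγ F _ i _ => ?_
  exact abs_le.1 (Real.abs_le_sqrt ((sq_le_trace_phi γ F i).trans (hM (mem_image_of_mem _ hγ))))

/-- A parameter, supported on the edges, whose image has the off-diagonal entries of `S`. -/
def edgeParam (Δ : Finset (Finset (Fin m))) (S : Matrix (Fin m) (Fin m) ℝ) : Param Δ :=
  fun F i => if F.1.card = 2 then
    -- The smaller endpoint of an edge gets 1. At the larger one the sum has a single term, the
    -- entry of `S` belonging to the edge.
    (if ∀ k ∈ F.1, i.1 ≤ k then 1 else ∑ k ∈ F.1.erase i, S k i) else 0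

lemma phi_edgeParam_apply_of_lt (hΔ : IsSimplicialComplexOn Δ) {S : Matrix (Fin m) (Fin m) ℝ}
    (hS : S ∈ symSpace (underlyingGraph Δ)) {i j : Fin m} (hij : i < j) :
    phi Δ (edgeParam Δ S) i j = S i j := by
  by_cases h : (underlyingGraph Δ).Adj i j
  · rw [phi_apply, Finset.sum_eq_single ⟨{i, j}, h.2⟩]
    · have h₁ : ({i, j} : Finset (Fin m)).erase j = {i} := by
        ext k
        simp only [Finset.mem_erase, Finset.mem_insert, Finset.mem_singleton]
        constructor
        · tauto
        · rintro rfl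
          exact ⟨hij.ne, Or.inl rfl⟩
      simp [Gam, edgeParam, Finset.card_pair hij.ne, hij.le, hij, h₁]
    · intro F _ hF
      by_cases hi : i ∈ F.1
      · by_cases hj : j ∈ F.1
        · have hc : F.1.card ≠ 2 := fun hc => hF (Subtype.ext (Finset.eq_of_subset_of_card_le
            (Finset.insert_subset hi (Finset.singleton_subset_iff.2 hj))
            (by rw [hc, Finset.card_pair hij.ne])).symm)
          simp [Gam, edgeParam, hc]
        · rw [Gam_eq_zero _ hj, mul_zero]
      · rw [Gam_eq_zero _ hi, zero_mul]
    · simp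
  · rw [phi_apply_eq_zero hΔ _ hij.ne h, hS.2 i j hij.ne h]

lemma phi_edgeParam_apply_of_ne (hΔ : IsSimplicialComplexOn Δ) {S : Matrix (Fin m) (Fin m) ℝ}
    (hS : S ∈ symSpace (underlyingGraph Δ)) {i j : Fin m} (hij : i ≠ j) :
    phi Δ (edgeParam Δ S) i j = S i j := by
  rcases lt_or_gt_of_ne hij with h | h
  · exact phi_edgeParam_apply_of_lt hΔ hS h
  · exact ((isSymm_phi _).apply j i).trans
      ((phi_edgeParam_apply_of_lt hΔ hS h).trans (hS.1.apply i j))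

/-- `γ` with a new value `a i` at the coordinate indexed by `i` and the vertex `{i}`. -/
def addVertices (γ : Param Δ) (a : Fin m → ℝ) : Param Δ :=
  fun F i => if F.1 = {i.1} then a i else γ F i

lemma Gam_addVertices (γ : Param Δ) (a : Fin m → ℝ) (i : Fin m)
    (F : {F : Finset (Fin m) // F ∈ Δ}) :
    Gam (addVertices γ a) i F = if F.1 = {i} then a i else Gam γ i F := by
  by_cases h : i ∈ F.1
  · simp [Gam, addVertices, h]
  · rw [Gam_eq_zero _ h, Gam_eq_zero _ h, if_neg]
    rintro h'
    exact h (by simp [h'])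

lemma Gam_edgeParam_singleton (S : Matrix (Fin m) (Fin m) ℝ) {i j : Fin m}
    {F : {F : Finset (Fin m) // F ∈ Δ}} (hF : F.1 = {j}) : Gam (edgeParam Δ S) i F = 0 := by
  simp [Gam, edgeParam, hF]

/-- Edge columns supply the off-diagonal entries; the column of the vertex {i} supplies the missing
positive amount on the diagonal as the square of a root. -/
lemma mem_range_phi_of_pos (hΔ : IsSimplicialComplexOn Δ) {S : Matrix (Fin m) (Fin m) ℝ}
    (hS : S ∈ symSpace (underlyingGraph Δ))
    (hpos : ∀ i, 0 < S i i - phi Δ (edgeParam Δ S) i i) : S ∈ range (phi Δ) := by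
  refine ⟨addVertices (edgeParam Δ S) fun i => √(S i i - phi Δ (edgeParam Δ S) i i), ?_⟩
  ext i j
  by_cases hij : i = j
  · subst hij
    obtain ⟨F₀, hF₀, hi⟩ := hΔ.ground_set i
    have hv : {i} ∈ Δ := hΔ.down_closed F₀ hF₀ _ (by simpa using hi)
    have key : ∀ F, Gam (addVertices (edgeParam Δ S)
        fun i => √(S i i - phi Δ (edgeParam Δ S) i i)) i F *
        Gam (addVertices (edgeParam Δ S) fun i => √(S i i - phi Δ (edgeParam Δ S) i i)) i F =
        Gam (edgeParam Δ S) i F * Gam (edgeParam Δ S) i F +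
          if F = ⟨{i}, hv⟩ then S i i - phi Δ (edgeParam Δ S) i i else 0 := fun F => by
      rw [Gam_addVertices]
      by_cases hF : F = ⟨{i}, hv⟩
      · have hF' : F.1 = {i} := congrArg Subtype.val hF
        rw [if_pos hF, if_pos hF', Gam_edgeParam_singleton S hF',
          Real.mul_self_sqrt (hpos i).le]
        ring
      · rw [if_neg hF, if_neg fun h => hF (Subtype.ext h), add_zero]
    rw [phi_apply, Finset.sum_congr rfl fun F _ => key F, Finset.sum_add_distrib, ← phi_apply]
    simp
  · rw [← phi_edgeParam_apply_of_ne hΔ hS hij, phi_apply, phi_apply]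
    -- A singleton column has only one nonzero row at most, so changing it leaves off-diagonal
    -- products alone.
    refine Finset.sum_congr rfl fun F _ => ?_
    rw [Gam_addVertices, Gam_addVertices]
    by_cases hi : F.1 = {i}
    · have hj : j ∉ F.1 := by simpa [hi] using Ne.symm hij
      rw [if_neg fun h : F.1 = {j} => hj (by simp [h]), Gam_eq_zero _ hj, mul_zero, mul_zero]
    · by_cases hj : F.1 = {j}
      · have hi' : i ∉ F.1 := by simpa [hj] using hij
        rw [if_neg hi, Gam_eq_zero _ hi', zero_mul, zero_mul]
      · rw [if_neg hi, if_neg hj]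

lemma continuous_edgeParam : Continuous (edgeParam Δ) := by
  refine continuous_pi fun F => continuous_pi fun i => ?_
  unfold edgeParam
  split_ifs <;> fun_prop

lemma edgeParam_diagonal (d : Fin m → ℝ) :
    edgeParam Δ (Matrix.diagonal d) = edgeParam Δ 0 := by
  funext F i
  have : ∑ k ∈ F.1.erase i.1, Matrix.diagonal d k i = 0 := Finset.sum_eq_zero fun k hk =>
    Matrix.diagonal_apply_ne _ (Finset.ne_of_mem_erase hk)
  simp [edgeParam, this]

lemma isFullDimensionalIn_range_phi (hΔ : IsSimplicialComplexOn Δ) :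
    IsFullDimensionalIn (symSpace (underlyingGraph Δ)) (range (phi Δ)) := by
  refine ⟨range_phi_subset_symSpace hΔ, ?_⟩
  -- The edge parameter of 0 still has entries 1, so its diagonal contribution must be exceeded; it
  -- is the same for every diagonal matrix.
  let d : Fin m → ℝ := fun i => phi Δ (edgeParam Δ 0) i i + 1
  have hd : Matrix.diagonal d ∈ symSpace (underlyingGraph Δ) :=
    ⟨Matrix.isSymm_diagonal d, fun i j hij _ => Matrix.diagonal_apply_ne _ hij⟩
  refine ⟨⟨_, hd⟩, mem_interior.2 ⟨{S | ∀ i, 0 < (S : Matrix (Fin m) (Fin m) ℝ) i i -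
    phi Δ (edgeParam Δ S) i i}, fun S hS => mem_range_phi_of_pos hΔ S.2 hS, ?_, fun i => ?_⟩⟩
  · rw [ofPred_forall]
    refine isOpen_iInter_of_finite fun i => isOpen_lt continuous_const ?_
    have h₁ : Continuous fun S : symSpace (underlyingGraph Δ) => phi Δ (edgeParam Δ S) :=
      continuous_phi.comp (continuous_edgeParam.comp continuous_subtype_val)
    exact (continuous_subtype_val.matrix_elem i i).sub (h₁.matrix_elem i i)
  · simp [edgeParam_diagonal, d]

/-- The graph of φ is cut out by polynomial equations in matrix entries and parameters; the
parameters are then projected away. -/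
lemma isSemialgebraicMatrixSet_range_phi : IsSemialgebraicMatrixSet (range (phi Δ)) := by
  let κ := Σ F : {F : Finset (Fin m) // F ∈ Δ}, {i : Fin m // i ∈ F.1}
  let G : Fin m → {F : Finset (Fin m) // F ∈ Δ} → MvPolynomial ((Fin m × Fin m) ⊕ κ) ℝ :=
    fun i F => if h : i ∈ F.1 then MvPolynomial.X (Sum.inr ⟨F, i, h⟩) else 0
  have hG : ∀ (x : Fin m × Fin m → ℝ) (y : κ → ℝ) i F,
      MvPolynomial.eval (Sum.elim x y) (G i F) = Gam (fun F i => y ⟨F, i⟩) i F := fun x y i F => by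
    by_cases h : i ∈ F.1 <;> simp [G, Gam, h]
  have hA : IsSemialgebraic (⋂ ij : Fin m × Fin m, {z : (Fin m × Fin m) ⊕ κ → ℝ |
      MvPolynomial.eval z (∑ F, G ij.1 F * G ij.2 F - MvPolynomial.X (Sum.inl ij)) = 0}) :=
    IsSemialgebraic.iInter fun _ => IsSemialgebraic.eq_zero _
  unfold IsSemialgebraicMatrixSet
  convert hA.exists_sum κ using 1
  ext x
  have key : ∀ y : κ → ℝ, (Sum.elim x y ∈ ⋂ ij : Fin m × Fin m, {z : (Fin m × Fin m) ⊕ κ → ℝ |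
      MvPolynomial.eval z (∑ F, G ij.1 F * G ij.2 F - MvPolynomial.X (Sum.inl ij)) = 0}) ↔
      phi Δ (fun F i => y ⟨F, i⟩) = Matrix.of fun i j => x (i, j) := fun y => by
    simp only [mem_iInter, mem_ofPred_eq, map_sub, map_sum, map_mul, hG, MvPolynomial.eval_X,
      Sum.elim_inl, sub_eq_zero, Prod.forall, ← Matrix.ext_iff, phi_apply, Matrix.of_apply]
  simp only [mem_ofPred_eq, key]
  exact ⟨fun ⟨γ, hγ⟩ => ⟨fun k => γ k.1 k.2, hγ⟩, fun ⟨y, hy⟩ => ⟨_, hy⟩⟩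

end Image

end SimplicialParam

theorem mainTheorem12 (m : ℕ) (hm : 0 < m) (Δ : Finset (Finset (Fin m)))
    (hΔ : SimplicialParam.IsSimplicialComplexOn Δ) :
    Set.range (SimplicialParam.phi Δ) ⊆
        SimplicialParam.psdCone (SimplicialParam.underlyingGraph Δ) ∧
      IsClosed (Set.range (SimplicialParam.phi Δ)) ∧
      SimplicialParam.IsFullDimensionalIn
        (SimplicialParam.symSpace (SimplicialParam.underlyingGraph Δ))
        (Set.range (SimplicialParam.phi Δ)) ∧
      SimplicialParam.IsSemialgebraicMatrixSet (Set.range (SimplicialParam.phi Δ)) :=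
  ⟨SimplicialParam.range_phi_subset_psdCone hΔ, SimplicialParam.isClosed_range_phi,
    SimplicialParam.isFullDimensionalIn_range_phi hΔ,
    SimplicialParam.isSemialgebraicMatrixSet_range_phi⟩
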